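/- Let $(X,\mathcal B)$ be a measurable space with $\mathcal B$ countably generated, let $m=(m_x)_{x\in X}$ be a random walk on it (probability measures on $\mathcal B$ with $x\mapsto m_x(B)$ measurable for every $B\in\mathcal B$), and let $\nu$ be a $\sigma$-finite measure that is reversible for $m$, i.e. $dm_x(y)\,d\nu(x)=dm_y(x)\,d\nu(y)$. Let $\nu\otimes m_x$ be the measure $dm_x(y)\,d\nu(x)$ on $X\times X$, and write $\nabla f(x,y)=f(y)-f(x)$. Let $\Omega\in\mathcal B$ with $0<\nu(\Omega)<\infty$, and put $\partial_m\Omega=\{x\in X\setminus\Omega : m_x(\Omega)>0\}$, $\Omega_m=\Omega\cup\partial_m\Omega$ and $L^p_0(\Omega_m,\nu)=\{f\in L^p(\Omega_m,\nu): f=0 \text{ a.e. on }\partial_m\Omega\}$. Say that $\Omega$ satisfies a $p$-Poincaré inequality if there is $\lambda>0$ with $$\lambda\int_\Omega|f|^p\,d\nu\le\int_{\Omega_m\times\Omega_m}|\nabla f(x,y)|^p\,d(\nu\otimes m_x)(x,y)\qquad\text{for all } f\in L^p_0(\Omega_m,\nu).$$ (a) Let $1<p<\infty$ and suppose that $\Omega$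 satisfies a $p$-Poincaré inequality. Then there is a unique $f_{\Omega,p}\in L^p_0(\Omega_m,\nu)$ (the $p$-torsion function of $\Omega$) such that $$-\int_{\Omega_m}|f_{\Omega,p}(y)-f_{\Omega,p}(x)|^{p-2}\,(f_{\Omega,p}(y)-f_{\Omega,p}(x))\,dm_x(y)=1\qquad\text{for } \nu\text{-a.e. } x\in\Omega,$$ it satisfies $f_{\Omega,p}\ge 0$ a.e., and the $m$-$p$-torsional rigidity $T_{m,p}(\Omega):=\left(\int_\Omega f_{\Omega,p}\,d\nu\right)^{p-1}$ satisfies $$T_{m,p}(\Omega)=\max_{g\in L^p_0(\Omega_m,\nu)\setminus\{0\}}\frac{\left(\int_\Omega|g|\,d\nu\right)^p}{\frac12\int_{\Omega_m\times\Omega_m}|\nabla g(x,y)|^p\,d(\nu\otimes m_x)(x,y)},$$ where the maximum is attained at $f_{\Omega,p}$. (b) Suppose that $\Omega$ satisfies a $2$-Poincaré inequality. Then there is a unique $f_\Omega\in L^2_0(\Omega_m,\nu)$ with $-\int_{\Omega_m}(f_\Omega(y)-f_\Omega(x))\,dm_x(y)=1$ for $\nu$-a.e. $x\in\Omega$, and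 the $m$-torsional rigidity $T_m(\Omega):=\int_\Omega f_\Omega\,d\nu$ satisfies $$T_m(\Omega)=T_{m,2}(\Omega)=\max_{g\in L^2_0(\Omega_m,\nu)\setminus\{0\}}\frac{\left(\int_\Omega g\,d\nu\right)^2}{\frac12\int_{\Omega_m\times\Omega_m}|\nabla g(x,y)|^2\,d(\nu\otimes m_x)(x,y)},$$ where the maximum is attained at $f_\Omega$. -/

import Mathlib

open MeasureTheory ProbabilityTheory Set

noncomputable section

namespace RandomWalk

variable {X : Type*} [MeasurableSpace X]

/-- The `m`-boundary of `Ω`: the points outside `Ω` from which the walk jumps into `Ω` with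
positive probability. -/
def mBoundary (m : Kernel X X) (Ω : Set X) : Set X :=
  {x | x ∉ Ω ∧ 0 < m x Ω}

/-- The `m`-closure `Ω_m` of `Ω`. -/
def mClosure (m : Kernel X X) (Ω : Set X) : Set X :=
  Ω ∪ mBoundary m Ω

/-- The nonlocal gradient `∇f(x,y) = f(y) - f(x)`. -/
def nonlocalGrad (f : X → ℝ) (z : X × X) : ℝ :=
  f z.2 - f z.1

/-- The space `L^p_0(Ω_m, ν)` of (classes of) functions in `L^p(Ω_m, ν)` that vanish almost
everywhere on the `m`-boundary of `Ω`. -/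
def LpZero (m : Kernel X X) (ν : Measure X) (Ω : Set X) (p : ℝ) :
    Submodule ℝ (Lp ℝ (ENNReal.ofReal p) (ν.restrict (mClosure m Ω))) where
  carrier := {f | ∀ᵐ x ∂ν.restrict (mClosure m Ω), x ∈ mBoundary m Ω → f x = 0}
  zero_mem' := by
    filter_upwards [Lp.coeFn_zero ℝ (ENNReal.ofReal p) (ν.restrict (mClosure m Ω))] with x hx _
    simpa using hx
  add_mem' := by
    intro f g hf hg
    filter_upwards [hf, hg, Lp.coeFn_add f g] with x h1 h2 h3 hx
    have h4 : (f + g : Lp ℝ (ENNReal.ofReal p) (ν.restrict (mClosure m Ω))) x = 0 := by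
      rw [h3, Pi.add_apply, h1 hx, h2 hx, add_zero]
    exact h4
  smul_mem' := by
    intro c f hf
    filter_upwards [hf, Lp.coeFn_smul c f] with x h1 h2 hx
    simp [h2, h1 hx]

/-- The integral of `|∇f(x,y)|^p` over `Ω_m × Ω_m` with respect to the measure `ν ⊗ m_x`. -/
def gradIntegral (m : Kernel X X) (ν : Measure X) (Ω : Set X) (p : ℝ) (f : X → ℝ) : ℝ :=
  ∫ z in mClosure m Ω ×ˢ mClosure m Ω, |nonlocalGrad f z| ^ p ∂(ν ⊗ₘ m)

/-- `Ω` satisfies a `p`-Poincaré inequality. -/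
def SatisfiesPoincare (m : Kernel X X) (ν : Measure X) (Ω : Set X) (p : ℝ) : Prop :=
  ∃ c : ℝ, 0 < c ∧ ∀ f : LpZero m ν Ω p,
    c * ∫ x in Ω, |f.1 x| ^ p ∂ν ≤ gradIntegral m ν Ω p f.1

/-- `f ∈ L^p_0(Ω_m, ν)` solves the homogeneous Dirichlet problem `-Δ_{m,p} f = g` in `Ω`,
`f = 0` on the `m`-boundary (the boundary condition is part of `f ∈ L^p_0(Ω_m, ν)`). -/
def IsDirichletSolution (m : Kernel X X) (ν : Measure X) (Ω : Set X) (p : ℝ) (g : X → ℝ)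
    (f : LpZero m ν Ω p) : Prop :=
  ∀ᵐ x ∂ν.restrict Ω,
    IntegrableOn (fun y => |f.1 y - f.1 x| ^ (p - 2) * (f.1 y - f.1 x)) (mClosure m Ω) (m x) ∧
    -∫ y in mClosure m Ω, |f.1 y - f.1 x| ^ (p - 2) * (f.1 y - f.1 x) ∂(m x) = g x

open Classical in
/-- The `p`-torsion function `f_{Ω,p}`: the solution of `-Δ_{m,p} f = 1` in `Ω`, `f = 0` on the
`m`-boundary (`0` if there is none). -/
def pTorsionFunction (m : Kernel X X) (ν : Measure X) (Ω : Set X) (p : ℝ) : LpZero m ν Ω p :=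
  if h : ∃ f : LpZero m ν Ω p, IsDirichletSolution m ν Ω p (fun _ => 1) f then h.choose else 0

/-- The `m`-`p`-torsional rigidity `T_{m,p}(Ω)`. -/
def pTorsionalRigidity (m : Kernel X X) (ν : Measure X) (Ω : Set X) (p : ℝ) : ℝ :=
  (∫ x in Ω, (pTorsionFunction m ν Ω p).1 x ∂ν) ^ (p - 1)

/-- The quotient `(∫_Ω |g| dν)^p / ((1/2) ∬ |∇g|^p d(ν ⊗ m_x))`. -/
def pTorsionQuotient (m : Kernel X X) (ν : Measure X) (Ω : Set X) (p : ℝ)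
    (g : LpZero m ν Ω p) : ℝ :=
  (∫ x in Ω, |g.1 x| ∂ν) ^ p / (1 / 2 * gradIntegral m ν Ω p g.1)

/-- `f` solves `-Δ_m f = 1` in `Ω`, `f = 0` on the `m`-boundary, in `L^2_0(Ω_m, ν)`. -/
def IsStressFunction (m : Kernel X X) (ν : Measure X) (Ω : Set X) (f : LpZero m ν Ω 2) : Prop :=
  ∀ᵐ x ∂ν.restrict Ω,
    IntegrableOn (fun y => f.1 y - f.1 x) (mClosure m Ω) (m x) ∧
    -∫ y in mClosure m Ω, (f.1 y - f.1 x) ∂(m x) = 1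

open Classical in
/-- The `m`-stress (or torsion) function `f_Ω`: the solution of `-Δ_m f = 1` in `Ω`, `f = 0` on
the `m`-boundary (`0` if there is none). -/
def stressFunction (m : Kernel X X) (ν : Measure X) (Ω : Set X) : LpZero m ν Ω 2 :=
  if h : ∃ f : LpZero m ν Ω 2, IsStressFunction m ν Ω f then h.choose else 0

/-- The `m`-torsional rigidity `T_m(Ω)`. -/
def torsionalRigidity (m : Kernel X X) (ν : Measure X) (Ω : Set X) : ℝ :=
  ∫ x in Ω, (stressFunction m ν Ω).1 x ∂ν

/-- The quotient `(∫_Ω g dν)^2 / ((1/2) ∬ |∇g|^2 d(ν ⊗ m_x))`. -/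
def torsionQuotient (m : Kernel X X) (ν : Measure X) (Ω : Set X) (g : LpZero m ν Ω 2) : ℝ :=
  (∫ x in Ω, g.1 x ∂ν) ^ 2 / (1 / 2 * gradIntegral m ν Ω 2 g.1)

end RandomWalk

end

/-! The torsion function is the minimiser over `L^p_0(Ω_m, ν)` of the convex energy `E f = ‖D f‖^p /
(2p) - ℓ f`, where `D f` is the nonlocal gradient of the zero extension of `f` and `ℓ f = ∫_Ω f dν`.
By reversibility `ν ⊗ₘ m` is symmetric with both marginals `ν`. Hence `D` is bounded, and, since a
step from `Ω` almost surely stays in `Ω_m`, `‖D f‖^p` is the gradient integral over `Ω_m × Ω_m`.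
Symmetry and the oddness of `signedPow` give an integration by parts that identifies the pointwise
equation with the weak Euler-Lagrange equation `1/2 ∫ signedPow (D f) * D h = ℓ h`
(`isDirichletSolution_iff_isWeakSolution`).

The Poincaré inequality says `c ‖f‖ ≤ ‖D f‖`, so `E` is coercive. A quantitative uniform convexity
of `L^p` makes minimising sequences Cauchy and minimisers unique (`existsUnique_isWeakSolution`).
Passing to `|f|` does not raise `E`, so the minimiser is nonnegative. Testing its equation with `g`
and applying Hölder gives `(ℓ g)^p ≤ (ℓ f)^(p-1) * (1/2 ‖D g‖^p)` (`IsWeakSolution.map_rpow_le`);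
testing with `f` gives `ℓ f = 1/2 ‖D f‖^p`, hence equality at `g = f`. This is the variational
formula. -/

noncomputable section

namespace RandomWalk

/-! ### Scalar convexity inequalities for `|·|^p` -/

/-- The odd extension `|a|^(p-2) a` of the power function `a ↦ a^(p-1)`. -/
def signedPow (p a : ℝ) : ℝ := |a| ^ (p - 2) * a

theorem abs_signedPow {p : ℝ} (hp : 1 < p) (a : ℝ) : |signedPow p a| = |a| ^ (p - 1) := by
  unfold signedPow
  rcases eq_or_ne a 0 with rfl | ha
  · simp [Real.zero_rpow (by linarith : p - 1 ≠ 0)]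
  · have h : 0 < |a| := abs_pos.mpr ha
    rw [abs_mul, abs_of_nonneg (Real.rpow_nonneg h.le _), ← Real.rpow_add_one h.ne']
    congr 1
    ring

theorem signedPow_mul_self {p : ℝ} (hp : 1 < p) (a : ℝ) : signedPow p a * a = |a| ^ p := by
  unfold signedPow
  rcases eq_or_ne a 0 with rfl | ha
  · simp [Real.zero_rpow (by linarith : p ≠ 0)]
  · have h : 0 < |a| := abs_pos.mpr ha
    rw [mul_assoc, ← abs_mul_abs_self, ← mul_assoc, ← Real.rpow_add_one h.ne',
      ← Real.rpow_add_one h.ne']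
    congr 1
    ring

theorem signedPow_neg (p a : ℝ) : signedPow p (-a) = -signedPow p a := by
  simp [signedPow]

theorem signedPow_eq_sub {p : ℝ} (hp : 1 < p) (a : ℝ) :
    signedPow p a = (max a 0) ^ (p - 1) - (max (-a) 0) ^ (p - 1) := by
  have key : ∀ b : ℝ, 0 ≤ b → signedPow p b = b ^ (p - 1) := by
    intro b hb
    have h := abs_signedPow hp b
    rwa [abs_of_nonneg hb, abs_of_nonneg] at h
    exact mul_nonneg (Real.rpow_nonneg (abs_nonneg _) _) hb
  have hz : (0 : ℝ) ^ (p - 1) = 0 := Real.zero_rpow (by linarith)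
  rcases le_total 0 a with ha | ha
  · rw [max_eq_left ha, max_eq_right (by linarith), hz, key a ha, sub_zero]
  · rw [max_eq_right ha, max_eq_left (by linarith), hz, ← key (-a) (by linarith), signedPow_neg]
    ring

theorem continuous_signedPow {p : ℝ} (hp : 1 < p) : Continuous (signedPow p) := by
  have h : signedPow p = fun a => (max a 0) ^ (p - 1) - (max (-a) 0) ^ (p - 1) :=
    funext (signedPow_eq_sub hp)
  rw [h]
  have hp' : 0 ≤ p - 1 := by linarith
  exact ((continuous_id.max continuous_const).rpow_const fun _ => Or.inr hp').sub
    ((continuous_neg.max continuous_const).rpow_const fun _ => Or.inr hp')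

/-- The graph of the convex function `|·|^p` lies above its tangent at `a`, whose slope is `p *
signedPow p a`. The proof is Young's inequality for `|a|^(p-1)` and `|b|`. -/
theorem abs_rpow_add_signedPow_le {p : ℝ} (hp : 1 < p) (a b : ℝ) :
    |a| ^ p + p * (signedPow p a * (b - a)) ≤ |b| ^ p := by
  have hpq := (Real.HolderConjugate.conjExponent hp).symm
  have h := Real.young_inequality_of_nonneg (Real.rpow_nonneg (abs_nonneg a) (p - 1))
    (abs_nonneg b) hpq
  have hq : (|a| ^ (p - 1)) ^ p.conjExponent = |a| ^ p := by
    rw [← Real.rpow_mul (abs_nonneg a), Real.conjExponent, mul_div_cancel₀]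
    linarith
  rw [hq] at h
  have h1 : signedPow p a * b ≤ |a| ^ (p - 1) * |b| := by
    rw [← abs_signedPow hp, ← abs_mul]
    exact le_abs_self _
  have h2 := h1.trans h
  have h3 : |a| ^ p / p.conjExponent = |a| ^ p * (p - 1) / p := by
    rw [Real.conjExponent]
    field_simp
  rw [h3, ← add_div, le_div_iff₀ (by linarith)] at h2
  rw [mul_sub, signedPow_mul_self hp]
  linarith

/-- If `|a| ≠ |b|`, strict convexity of the power on `[0, ∞)` applies; otherwise `a = -b ≠ 0` and
the midpoint is zero. -/
theorem abs_midpoint_rpow_lt {p : ℝ} (hp : 1 < p) {a b : ℝ} (hab : a ≠ b) :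
    |(a + b) / 2| ^ p < (|a| ^ p + |b| ^ p) / 2 := by
  have hp0 : 0 < p := by linarith
  have hle : |(a + b) / 2| ≤ (|a| + |b|) / 2 := by
    rw [abs_div, abs_two]
    linarith [abs_add_le a b]
  rcases eq_or_ne |a| |b| with h | h
  · have hb : a = -b := (abs_eq_abs.mp h).resolve_left hab
    have hb0 : b ≠ 0 := by
      rintro rfl
      exact hab (by simpa using hb)
    subst hb
    have : 0 < |b| ^ p := Real.rpow_pos_of_pos (abs_pos.mpr hb0) _
    simpa [Real.zero_rpow hp0.ne'] using this
  · refine (Real.rpow_le_rpow (abs_nonneg _) hle hp0.le).trans_lt ?_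
    have h2 := (strictConvexOn_rpow hp).2 (abs_nonneg a) (abs_nonneg b) h
      (by norm_num : (0 : ℝ) < 1 / 2) (by norm_num : (0 : ℝ) < 1 / 2) (by norm_num)
    simp only [smul_eq_mul] at h2
    have e : (|a| + |b|) / 2 = 1 / 2 * |a| + 1 / 2 * |b| := by ring
    rw [e]
    linarith

/-- A quantitative form of the strict convexity of `|·|^p`. -/
theorem exists_abs_sub_rpow_le {p : ℝ} (hp : 1 < p) {ε : ℝ} (hε : 0 < ε) :
    ∃ C : ℝ, 0 ≤ C ∧ ∀ a b : ℝ, |a - b| ^ p ≤ ε * (|a| ^ p + |b| ^ p) +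
      C * ((|a| ^ p + |b| ^ p) / 2 - |(a + b) / 2| ^ p) := by
  have hp0 : 0 < p := by linarith
  have hpow : ∀ {g : ℝ × ℝ → ℝ}, Continuous g → Continuous fun z => |g z| ^ p :=
    fun hg => hg.abs.rpow_const fun _ => Or.inr hp0.le
  have c1 := hpow continuous_fst
  have c2 := hpow continuous_snd
  have c3 : Continuous fun z : ℝ × ℝ => |z.1 - z.2| ^ p := hpow (by fun_prop)
  have c4 : Continuous fun z : ℝ × ℝ => |(z.1 + z.2) / 2| ^ p := hpow (by fun_prop)
  set g : ℝ × ℝ → ℝ := fun z => (|z.1| ^ p + |z.2| ^ p) / 2 - |(z.1 + z.2) / 2| ^ p with hg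
  have cg : Continuous g := ((c1.add c2).div_const 2).sub c4
  have hg0 : ∀ z, 0 ≤ g z := by
    intro z
    rcases eq_or_ne z.1 z.2 with h | h
    · have e : (z.2 + z.2) / 2 = z.2 := by ring
      simp [hg, h, e]
    · exact (sub_pos.mpr (abs_midpoint_rpow_lt hp h)).le
  -- `S` is the part of the unit sphere where the `ε` term alone may not suffice. There `a ≠ b`, so
  -- the convexity defect `g` is positive, and by compactness `|a - b|^p / g` is bounded on `S`.
  set S : Set (ℝ × ℝ) := Metric.sphere 0 1 ∩
    {z | ε * (|z.1| ^ p + |z.2| ^ p) ≤ |z.1 - z.2| ^ p} with hS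
  have hSc : IsCompact S := (isCompact_sphere 0 1).inter_right
    (isClosed_le (continuous_const.mul (c1.add c2)) c3)
  have hgS : ∀ z ∈ S, 0 < g z := by
    rintro z ⟨hz1, hz2⟩
    refine sub_pos.mpr (abs_midpoint_rpow_lt hp fun h => ?_)
    simp only [mem_ofPred_eq, h, sub_self, abs_zero, Real.zero_rpow hp0.ne'] at hz2
    have h2 : |z.2| ^ p = 0 := by
      have := Real.rpow_nonneg (abs_nonneg z.2) p
      nlinarith
    have h3 : z.2 = 0 := by
      rw [Real.rpow_eq_zero (abs_nonneg _) hp0.ne'] at h2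
      exact abs_eq_zero.mp h2
    have : z = 0 := Prod.ext (h.trans h3) h3
    simp [this] at hz1
  obtain ⟨C, hC0, hC⟩ : ∃ C : ℝ, 0 ≤ C ∧ ∀ z ∈ S, |z.1 - z.2| ^ p ≤ C * g z := by
    rcases S.eq_empty_or_nonempty with h | h
    · exact ⟨0, le_rfl, by simp [h]⟩
    · have hcont : ContinuousOn (fun z : ℝ × ℝ => |z.1 - z.2| ^ p / g z) S :=
        c3.continuousOn.div cg.continuousOn fun z hz => (hgS z hz).ne'
      obtain ⟨w, hw, hmax⟩ := hSc.exists_isMaxOn h hcont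
      refine ⟨_, div_nonneg (Real.rpow_nonneg (abs_nonneg (w.1 - w.2)) p) (hg0 w), fun z hz => ?_⟩
      have := hmax hz
      simp only [mem_ofPred_eq] at this
      rwa [div_le_iff₀ (hgS z hz)] at this
  refine ⟨C, hC0, fun a b => ?_⟩
  have hsph : ∀ z : ℝ × ℝ, z ∈ Metric.sphere (0 : ℝ × ℝ) 1 →
      |z.1 - z.2| ^ p ≤ ε * (|z.1| ^ p + |z.2| ^ p) + C * g z := by
    intro z hz
    by_cases h : ε * (|z.1| ^ p + |z.2| ^ p) ≤ |z.1 - z.2| ^ p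
    · have h1 := hC z ⟨hz, h⟩
      have h2 : 0 ≤ ε * (|z.1| ^ p + |z.2| ^ p) := by positivity
      linarith
    · have := mul_nonneg hC0 (hg0 z)
      linarith [not_le.mp h]
  rcases eq_or_ne ((a, b) : ℝ × ℝ) 0 with h0 | h0
  · obtain ⟨rfl, rfl⟩ := Prod.mk.inj h0
    simp [Real.zero_rpow hp0.ne']
  -- Both sides are homogeneous of degree `p`, so the bound on the sphere scales to every nonzero
  -- pair.
  · set r := ‖((a, b) : ℝ × ℝ)‖ with hr
    have hr0 : 0 < r := norm_pos_iff.mpr h0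
    have h := hsph (r⁻¹ • (a, b)) (by
      rw [mem_sphere_zero_iff_norm, norm_smul, norm_inv, norm_norm, inv_mul_cancel₀ hr0.ne'])
    have hsc : ∀ x : ℝ, |r⁻¹ * x| ^ p = (r⁻¹) ^ p * |x| ^ p := by
      intro x
      rw [abs_mul, abs_of_pos (inv_pos.mpr hr0), Real.mul_rpow (inv_pos.mpr hr0).le (abs_nonneg _)]
    have e1 : r⁻¹ * a - r⁻¹ * b = r⁻¹ * (a - b) := by ring
    have e2 : (r⁻¹ * a + r⁻¹ * b) / 2 = r⁻¹ * ((a + b) / 2) := by ring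
    simp only [hg, Prod.smul_mk, smul_eq_mul, e1, e2, hsc] at h
    have hk : 0 < (r⁻¹) ^ p := Real.rpow_pos_of_pos (inv_pos.mpr hr0) p
    refine le_of_mul_le_mul_left (h.trans (le_of_eq ?_)) hk
    ring

/-! ### Integrated inequalities in `L^p` -/

section Lp

variable {Y : Type*} [MeasurableSpace Y] {μ : Measure Y} {p : ℝ}

theorem memLp_integrable_abs_rpow (hp : 1 < p) {u : Y → ℝ} (hu : MemLp u (ENNReal.ofReal p) μ) :
    Integrable (fun y => |u y| ^ p) μ := by
  have h := hu.integrable_norm_rpow (by simp; linarith) ENNReal.ofReal_ne_top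
  simpa [ENNReal.toReal_ofReal (by linarith : 0 ≤ p)] using h

theorem toReal_eLpNorm_rpow (hp : 1 < p) {u : Y → ℝ} (hu : MemLp u (ENNReal.ofReal p) μ) :
    (eLpNorm u (ENNReal.ofReal p) μ).toReal ^ p = ∫ y, |u y| ^ p ∂μ := by
  have hp0 : 0 < p := by linarith
  rw [toReal_eLpNorm hu.1, lpNorm_eq_integral_norm_rpow_toReal (by simpa using hp0)
    ENNReal.ofReal_ne_top hu.1, ENNReal.toReal_ofReal hp0.le, ← Real.rpow_mul, inv_mul_cancel₀ hp0.ne',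
    Real.rpow_one]
  · simp
  · exact integral_nonneg fun _ => by positivity

theorem Lp_norm_rpow_eq (hp : 1 < p) (u : Lp ℝ (ENNReal.ofReal p) μ) :
    ‖u‖ ^ p = ∫ y, |u y| ^ p ∂μ := by
  rw [Lp.norm_def, toReal_eLpNorm_rpow hp (Lp.memLp u)]

theorem memLp_signedPow (hp : 1 < p) {u : Y → ℝ} (hu : MemLp u (ENNReal.ofReal p) μ) :
    MemLp (fun y => signedPow p (u y)) (ENNReal.ofReal p.conjExponent) μ := by
  have hq := (Real.HolderConjugate.conjExponent hp).symm.pos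
  have hm : AEStronglyMeasurable (fun y => signedPow p (u y)) μ :=
    (continuous_signedPow hp).comp_aestronglyMeasurable hu.1
  rw [← integrable_norm_rpow_iff hm (by simpa using hq) ENNReal.ofReal_ne_top]
  refine (memLp_integrable_abs_rpow hp hu).congr (Filter.Eventually.of_forall fun y => ?_)
  simp only [Real.norm_eq_abs, abs_signedPow hp, ENNReal.toReal_ofReal hq.le]
  rw [← Real.rpow_mul (abs_nonneg _), Real.conjExponent, mul_div_cancel₀]
  linarith

theorem integrable_signedPow_mul (hp : 1 < p) {u v : Y → ℝ} (hu : MemLp u (ENNReal.ofReal p) μ)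
    (hv : MemLp v (ENNReal.ofReal p) μ) : Integrable (fun y => signedPow p (u y) * v y) μ := by
  have := (Real.HolderConjugate.conjExponent hp).symm.ennrealOfReal
  exact (memLp_signedPow hp hu).integrable_mul hv

/-- Hölder's inequality, since `|signedPow p u|^q = |u|^p` for the conjugate exponent `q = p / (p -
1)`. -/
theorem integral_signedPow_mul_le [Fact (1 ≤ ENNReal.ofReal p)] (hp : 1 < p) (u v : Lp ℝ (ENNReal.ofReal p) μ) :
    ∫ y, signedPow p (u y) * v y ∂μ ≤ ‖u‖ ^ (p - 1) * ‖v‖ := by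
  have hpq := (Real.HolderConjugate.conjExponent hp).symm
  have hp0 : 0 < p := by linarith
  have h := integral_mul_le_Lp_mul_Lq_of_nonneg hpq
    (Filter.Eventually.of_forall fun y => abs_nonneg (signedPow p (u y)))
    (Filter.Eventually.of_forall fun y => abs_nonneg (v y))
    (memLp_signedPow hp (Lp.memLp u)).norm (Lp.memLp v).norm
  have e1 : ∀ y, |signedPow p (u y)| ^ p.conjExponent = |u y| ^ p := by
    intro y
    rw [abs_signedPow hp, ← Real.rpow_mul (abs_nonneg _), Real.conjExponent, mul_div_cancel₀]
    linarith
  simp only [e1, ← Lp_norm_rpow_eq hp] at h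
  rw [← Real.rpow_mul (norm_nonneg _), ← Real.rpow_mul (norm_nonneg _),
    mul_one_div_cancel hp0.ne', Real.rpow_one] at h
  have e2 : p * (1 / p.conjExponent) = p - 1 := by
    rw [Real.conjExponent]
    field_simp
  rw [e2] at h
  refine (integral_mono_ae (integrable_signedPow_mul hp (Lp.memLp u) (Lp.memLp v)) ?_ ?_).trans h
  · simpa [abs_mul] using (integrable_signedPow_mul hp (Lp.memLp u) (Lp.memLp v)).abs
  · exact Filter.Eventually.of_forall fun y => by
      simpa only [← abs_mul] using le_abs_self _

theorem integral_signedPow_mul_self (hp : 1 < p) (u : Lp ℝ (ENNReal.ofReal p) μ) :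
    ∫ y, signedPow p (u y) * u y ∂μ = ‖u‖ ^ p := by
  simp only [signedPow_mul_self hp, Lp_norm_rpow_eq hp]

theorem norm_rpow_add_integral_signedPow_le (hp : 1 < p) (u v : Lp ℝ (ENNReal.ofReal p) μ) :
    ‖u‖ ^ p + p * ∫ y, signedPow p (u y) * (v - u : Lp ℝ (ENNReal.ofReal p) μ) y ∂μ ≤ ‖v‖ ^ p := by
  rw [Lp_norm_rpow_eq hp u, Lp_norm_rpow_eq hp v, ← integral_const_mul, ← integral_add
    (memLp_integrable_abs_rpow hp (Lp.memLp u))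
    ((integrable_signedPow_mul hp (Lp.memLp u) (Lp.memLp _)).const_mul p)]
  refine integral_mono_ae ((memLp_integrable_abs_rpow hp (Lp.memLp u)).add
    ((integrable_signedPow_mul hp (Lp.memLp u) (Lp.memLp _)).const_mul p))
    (memLp_integrable_abs_rpow hp (Lp.memLp v)) ?_
  filter_upwards [Lp.coeFn_sub v u] with y hy
  simp only [hy, Pi.sub_apply]
  exact abs_rpow_add_signedPow_le hp _ _

/-- A quantitative form of the uniform convexity of `L^p`. -/
theorem exists_norm_sub_rpow_le (μ : Measure Y) (hp : 1 < p) {ε : ℝ} (hε : 0 < ε) :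
    ∃ C : ℝ, 0 ≤ C ∧ ∀ u v : Lp ℝ (ENNReal.ofReal p) μ, ‖u - v‖ ^ p ≤ ε * (‖u‖ ^ p + ‖v‖ ^ p) +
      C * ((‖u‖ ^ p + ‖v‖ ^ p) / 2 - ‖(1 / 2 : ℝ) • (u + v)‖ ^ p) := by
  obtain ⟨C, hC0, hC⟩ := exists_abs_sub_rpow_le hp hε
  refine ⟨C, hC0, fun u v => ?_⟩
  have iu := memLp_integrable_abs_rpow hp (Lp.memLp u)
  have iv := memLp_integrable_abs_rpow hp (Lp.memLp v)
  have im := memLp_integrable_abs_rpow hp (Lp.memLp ((1 / 2 : ℝ) • (u + v)))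
  have is : Integrable (fun y => |u y| ^ p + |v y| ^ p) μ := iu.add iv
  have ig : Integrable (fun y => C * ((|u y| ^ p + |v y| ^ p) / 2 -
      |((1 / 2 : ℝ) • (u + v) : Lp ℝ (ENNReal.ofReal p) μ) y| ^ p)) μ :=
    ((is.div_const 2).sub im).const_mul C
  simp only [Lp_norm_rpow_eq hp]
  rw [← integral_add iu iv, ← integral_const_mul, ← integral_div, ← integral_sub
    (is.div_const 2) im, ← integral_const_mul, ← integral_add (is.const_mul ε) ig]
  refine integral_mono_ae (memLp_integrable_abs_rpow hp (Lp.memLp (u - v)))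
    ((is.const_mul ε).add ig) ?_
  filter_upwards [Lp.coeFn_sub u v, Lp.coeFn_add u v, Lp.coeFn_smul (1 / 2 : ℝ) (u + v)]
    with y h1 h2 h3
  have e : (1 / 2 : ℝ) * (u y + v y) = (u y + v y) / 2 := by ring
  simp only [h1, h2, h3, Pi.sub_apply, Pi.add_apply, Pi.smul_apply, smul_eq_mul, e]
  exact hC _ _

end Lp

/-! ### Minimisation of an abstract `p`-energy -/

section Variational

open Filter Topology

variable {F : Type*} [NormedAddCommGroup F] [NormedSpace ℝ F] {Y : Type*} [MeasurableSpace Y]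
  {μ : Measure Y} {p : ℝ} [Fact (1 ≤ ENNReal.ofReal p)]

/-- The `p`-energy `‖D f‖^p / (2 p) - ℓ f`. -/
def energy (D : F →L[ℝ] Lp ℝ (ENNReal.ofReal p) μ) (ℓ : F →L[ℝ] ℝ) (f : F) : ℝ :=
  ‖D f‖ ^ p / (2 * p) - ℓ f

/-- The weak form of the Euler-Lagrange equation of `energy D ℓ`. -/
def IsWeakSolution (D : F →L[ℝ] Lp ℝ (ENNReal.ofReal p) μ) (ℓ : F →L[ℝ] ℝ) (f : F) : Prop :=
  ∀ h, 1 / 2 * ∫ y, signedPow p (D f y) * D h y ∂μ = ℓ h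

variable {D : F →L[ℝ] Lp ℝ (ENNReal.ofReal p) μ} {ℓ : F →L[ℝ] ℝ}

/-- By convexity a critical point is a global minimiser: the tangent inequality at `D f` is combined
with the equation tested on `g - f`. -/
theorem IsWeakSolution.energy_le (hp : 1 < p) {f : F} (hf : IsWeakSolution D ℓ f) (g : F) :
    energy D ℓ f ≤ energy D ℓ g := by
  have h := norm_rpow_add_integral_signedPow_le hp (D f) (D g)
  have h2 := hf (g - f)
  rw [← map_sub] at h
  rw [map_sub ℓ] at h2
  unfold energy
  have hp0 : 0 < p := by linarith
  have e : ∫ y, signedPow p (D f y) * D (g - f) y ∂μ = 2 * (ℓ g - ℓ f) := by linarith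
  rw [e] at h
  have h3 : ‖D f‖ ^ p / (2 * p) + (ℓ g - ℓ f) ≤ ‖D g‖ ^ p / (2 * p) := by
    rw [le_div_iff₀ (by positivity), add_mul, div_mul_cancel₀ _ (by positivity)]
    linarith
  linarith

/-- The minimiser is compared with `f + t • h`, using the tangent inequality based at the perturbed
point. Dividing by `t` and letting `t → 0` gives the claim without differentiating `‖·‖^p`. -/
theorem le_integral_signedPow_of_energy_le (hp : 1 < p) {f : F}
    (hf : ∀ g, energy D ℓ f ≤ energy D ℓ g) (h : F) :
    ℓ h ≤ 1 / 2 * ∫ y, signedPow p (D f y) * D h y ∂μ := by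
  have hp0 : 0 < p := by linarith
  have key : ∀ t ∈ Ioo (0 : ℝ) 1,
      ℓ h ≤ 1 / 2 * ∫ y, signedPow p (D f y + t * D h y) * D h y ∂μ := by
    rintro t ⟨ht, -⟩
    have h1 := norm_rpow_add_integral_signedPow_le hp (D (f + t • h)) (D f)
    have h2 := hf (f + t • h)
    have e : ∫ y, signedPow p (D (f + t • h) y) * (D f - D (f + t • h) :
        Lp ℝ (ENNReal.ofReal p) μ) y ∂μ =
        -(t * ∫ y, signedPow p (D f y + t * D h y) * D h y ∂μ) := by
      rw [← integral_const_mul, ← integral_neg]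
      refine integral_congr_ae ?_
      rw [map_add, map_smul]
      filter_upwards [Lp.coeFn_add (D f) (t • D h), Lp.coeFn_smul t (D h),
        Lp.coeFn_sub (D f) (D f + t • D h)] with y h3 h4 h5
      simp only [h3, h4, h5, Pi.add_apply, Pi.sub_apply, Pi.smul_apply, smul_eq_mul]
      ring
    rw [e] at h1
    simp only [energy, map_add ℓ, map_smul ℓ, smul_eq_mul] at h2
    set I := ∫ y, signedPow p (D f y + t * D h y) * D h y ∂μ
    have h3 : ‖D (f + t • h)‖ ^ p / (2 * p) ≤ ‖D f‖ ^ p / (2 * p) + t * I / 2 := by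
      rw [div_le_iff₀ (by positivity), add_mul, div_mul_cancel₀ _ (by positivity)]
      linarith
    have h4 : t * ℓ h ≤ t * (1 / 2 * I) := by linarith
    exact le_of_mul_le_mul_left h4 ht
  have lim : Tendsto (fun t : ℝ => ∫ y, signedPow p (D f y + t * D h y) * D h y ∂μ) (𝓝[>] 0)
      (𝓝 (∫ y, signedPow p (D f y) * D h y ∂μ)) := by
    have hdom : MemLp (fun y => |D f y| + |D h y|) (ENNReal.ofReal p) μ :=
      (Lp.memLp (D f)).abs.add (Lp.memLp (D h)).abs
    refine tendsto_integral_filter_of_dominated_convergence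
      (fun y => |signedPow p (|D f y| + |D h y|) * D h y|) ?_ ?_
      (integrable_signedPow_mul hp hdom (Lp.memLp (D h))).abs ?_
    · refine Eventually.of_forall fun t => ?_
      have hm : AEStronglyMeasurable (fun y => D f y + t * D h y) μ :=
        (Lp.aestronglyMeasurable _).add ((Lp.aestronglyMeasurable _).const_mul t)
      exact ((continuous_signedPow hp).comp_aestronglyMeasurable hm).mul
        (Lp.aestronglyMeasurable _)
    · filter_upwards [Ioo_mem_nhdsGT (zero_lt_one (α := ℝ))] with t ht
      refine Eventually.of_forall fun y => ?_
      rw [Real.norm_eq_abs, abs_mul, abs_mul, abs_signedPow hp, abs_signedPow hp]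
      refine mul_le_mul_of_nonneg_right (Real.rpow_le_rpow (abs_nonneg _) ?_ (by linarith))
        (abs_nonneg _)
      refine ((abs_add_le _ _).trans ?_).trans (le_abs_self _)
      rw [abs_mul, abs_of_pos ht.1]
      nlinarith [abs_nonneg (D h y), ht.2]
    · refine Eventually.of_forall fun y => ?_
      have hc : Continuous fun t : ℝ => signedPow p (D f y + t * D h y) * D h y :=
        ((continuous_signedPow hp).comp (by fun_prop)).mul continuous_const
      simpa using (hc.tendsto 0).mono_left nhdsWithin_le_nhds
  refine ge_of_tendsto (lim.const_mul (1 / 2)) ?_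
  filter_upwards [Ioo_mem_nhdsGT (zero_lt_one (α := ℝ))] with t ht using key t ht

theorem isWeakSolution_of_energy_le (hp : 1 < p) {f : F}
    (hf : ∀ g, energy D ℓ f ≤ energy D ℓ g) : IsWeakSolution D ℓ f := by
  intro h
  refine le_antisymm ?_ (le_integral_signedPow_of_energy_le hp hf h)
  have h1 := le_integral_signedPow_of_energy_le hp hf (-h)
  have e : ∫ y, signedPow p (D f y) * D (-h) y ∂μ = -∫ y, signedPow p (D f y) * D h y ∂μ := by
    rw [← integral_neg, map_neg]
    refine integral_congr_ae ?_
    filter_upwards [Lp.coeFn_neg (D h)] with y hy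
    simp only [hy, Pi.neg_apply, mul_neg]
  rw [e, map_neg] at h1
  linarith

/-- Coercivity: `ℓ f` is at most linear in `‖D f‖`, and as `p > 1` half of the power term absorbs it
up to a constant. -/
theorem exists_norm_rpow_le_energy (hp : 1 < p) {c : ℝ} (hc : 0 < c)
    (hD : ∀ f, c * ‖f‖ ≤ ‖D f‖) :
    ∃ K : ℝ, ∀ f, ‖D f‖ ^ p / (4 * p) ≤ energy D ℓ f + K := by
  have hp0 : 0 < p := by linarith
  set M := ‖ℓ‖ / c with hM
  have hM0 : 0 ≤ M := by positivity
  have hl : ∀ f, ℓ f ≤ M * ‖D f‖ := by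
    intro f
    calc ℓ f ≤ ‖ℓ‖ * ‖f‖ := (le_abs_self _).trans (ℓ.le_opNorm f)
      _ = M * (c * ‖f‖) := by rw [hM]; field_simp
      _ ≤ M * ‖D f‖ := mul_le_mul_of_nonneg_left (hD f) hM0
  -- The threshold beyond which `M * t ≤ t ^ p / (4 * p)`.
  set T := (4 * p * M) ^ (1 / (p - 1)) with hT
  have hT0 : 0 ≤ T := by positivity
  refine ⟨M * T, fun f => ?_⟩
  have hle := hl f
  set t := ‖D f‖ with ht
  have ht0 : 0 ≤ t := norm_nonneg _
  have hmain : M * t ≤ t ^ p / (4 * p) + M * T := by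
    rcases le_total t T with h | h
    · have h1 := mul_le_mul_of_nonneg_left h hM0
      have h2 : 0 ≤ t ^ p / (4 * p) := by positivity
      linarith
    · have h1 : 4 * p * M ≤ t ^ (p - 1) := by
        have h2 := Real.rpow_le_rpow hT0 h (by linarith : 0 ≤ p - 1)
        rwa [hT, ← Real.rpow_mul (by positivity), one_div_mul_cancel (by linarith),
          Real.rpow_one] at h2
      have h2 : t ^ p = t ^ (p - 1) * t := by
        rw [← Real.rpow_add_one' ht0 (by linarith), sub_add_cancel]
      have h3 : M * t ≤ t ^ p / (4 * p) := by
        rw [le_div_iff₀ (by positivity), h2]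
        nlinarith
      have h4 : 0 ≤ M * T := by positivity
      linarith
  have e : t ^ p / (2 * p) = t ^ p / (4 * p) + t ^ p / (4 * p) := by
    field_simp
    ring
  unfold energy
  rw [← ht, e]
  linarith

/-- The energy at the midpoint of `f` and `g` is at least `i` and `ℓ` is linear, so the convexity
defect of `‖·‖^p` at `D f`, `D g` is controlled by the energy excesses over `i`. The constant
depends on neither `i` nor `f`, `g`. -/
theorem exists_norm_map_sub_rpow_le (D : F →L[ℝ] Lp ℝ (ENNReal.ofReal p) μ) (ℓ : F →L[ℝ] ℝ)
    (hp : 1 < p) {ε : ℝ} (hε : 0 < ε) :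
    ∃ C : ℝ, 0 ≤ C ∧ ∀ i : ℝ, (∀ h, i ≤ energy D ℓ h) → ∀ f g,
      ‖D (f - g)‖ ^ p ≤ ε * (‖D f‖ ^ p + ‖D g‖ ^ p) +
        C * ((energy D ℓ f - i) + (energy D ℓ g - i)) := by
  obtain ⟨C, hC0, hC⟩ := exists_norm_sub_rpow_le μ hp hε
  have hp0 : 0 < p := by linarith
  refine ⟨C * p, by positivity, fun i hi f g => ?_⟩
  rw [map_sub]
  refine (hC (D f) (D g)).trans (add_le_add_right ?_ _)
  rw [mul_assoc]
  refine mul_le_mul_of_nonneg_left ?_ hC0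
  have h := hi ((1 / 2 : ℝ) • (f + g))
  simp only [energy, map_smul, map_add, smul_eq_mul] at h ⊢
  have h1 : p * (i + 1 / 2 * (ℓ f + ℓ g)) ≤ ‖(1 / 2 : ℝ) • (D f + D g)‖ ^ p / 2 := by
    have h2 : i + 1 / 2 * (ℓ f + ℓ g) ≤ ‖(1 / 2 : ℝ) • (D f + D g)‖ ^ p / (2 * p) := by linarith
    rw [le_div_iff₀ (by positivity)] at h2
    linarith
  have e : p * (‖D f‖ ^ p / (2 * p) - ℓ f - i + (‖D g‖ ^ p / (2 * p) - ℓ g - i)) =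
      (‖D f‖ ^ p + ‖D g‖ ^ p) / 2 - p * (ℓ f + ℓ g) - 2 * p * i := by
    field_simp
    ring
  rw [e]
  linarith

/-- For two minimisers the excess terms vanish, leaving `‖D (f - g)‖^p ≤ ε * B` for every `ε > 0`.
-/
theorem eq_of_energy_le (hp : 1 < p) (hD : ∀ f, D f = 0 → f = 0) {f g : F}
    (hf : ∀ h, energy D ℓ f ≤ energy D ℓ h) (hg : energy D ℓ g ≤ energy D ℓ f) : f = g := by
  have hp0 : 0 < p := by linarith
  have hfg : energy D ℓ g = energy D ℓ f := le_antisymm hg (hf g)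
  set B := ‖D f‖ ^ p + ‖D g‖ ^ p with hB
  have hB0 : 0 ≤ B := by positivity
  have hle : ‖D (f - g)‖ ^ p ≤ 0 := by
    refine le_of_forall_pos_le_add fun δ hδ => ?_
    obtain ⟨C, -, hC⟩ := exists_norm_map_sub_rpow_le D ℓ hp
      (ε := δ / (B + 1)) (by positivity)
    have h := hC _ hf f g
    rw [hfg, sub_self, add_zero, mul_zero, add_zero, ← hB] at h
    refine h.trans ?_
    rw [div_mul_eq_mul_div, div_le_iff₀ (by positivity)]
    nlinarith
  have h0 : ‖D (f - g)‖ = 0 := by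
    rw [← Real.rpow_eq_zero (norm_nonneg _) hp0.ne']
    exact le_antisymm hle (by positivity)
  exact sub_eq_zero.mp (hD _ (norm_eq_zero.mp h0))

/-- A minimising sequence is bounded under `D` by coercivity, hence Cauchy by uniform convexity; its
limit minimises by continuity of the energy. -/
theorem exists_forall_energy_le [CompleteSpace F] (hp : 1 < p) {c : ℝ} (hc : 0 < c)
    (hD : ∀ f, c * ‖f‖ ≤ ‖D f‖) : ∃ f, ∀ g, energy D ℓ f ≤ energy D ℓ g := by
  have hp0 : 0 < p := by linarith
  obtain ⟨K, hK⟩ := exists_norm_rpow_le_energy (ℓ := ℓ) hp hc hD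
  have hbdd : BddBelow (range (energy D ℓ)) := by
    refine ⟨-K, ?_⟩
    rintro _ ⟨f, rfl⟩
    have h1 := hK f
    have h2 : 0 ≤ ‖D f‖ ^ p / (4 * p) := by positivity
    linarith
  set i := ⨅ f, energy D ℓ f with hi
  have hle : ∀ f, i ≤ energy D ℓ f := fun f => ciInf_le hbdd f
  have hex : ∀ n : ℕ, ∃ f, energy D ℓ f < i + 1 / ((n : ℝ) + 1) := fun n =>
    exists_lt_of_ciInf_lt (lt_add_of_pos_right i Nat.one_div_pos_of_nat)
  choose u hu using hex
  set B := 4 * p * (i + 1 + K) with hB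
  have huB : ∀ n, ‖D (u n)‖ ^ p ≤ B := by
    intro n
    have h1 := hK (u n)
    rw [div_le_iff₀ (by positivity)] at h1
    have h2 : 1 / ((n : ℝ) + 1) ≤ 1 := by
      rw [div_le_one (by positivity)]
      linarith [n.cast_nonneg (α := ℝ)]
    have h3 := hu n
    rw [hB]
    nlinarith
  have hB0 : 0 ≤ B := le_trans (by positivity) (huB 0)
  have hcauchy : CauchySeq u := by
    rw [Metric.cauchySeq_iff]
    intro δ hδ
    have hη : 0 < (c * δ) ^ p := by positivity
    set η := (c * δ) ^ p with hη'
    -- The target `η` is split: less than `η / 2` from the `ε` term, as both norms to the power `p`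
    -- are at most `B`, and at most `η / 4` from each energy excess.
    obtain ⟨C, hC0, hC⟩ := exists_norm_map_sub_rpow_le D ℓ hp
      (ε := η / (4 * (B + 1))) (by positivity)
    obtain ⟨N, hN⟩ := exists_nat_gt (4 * C / η)
    refine ⟨N, fun n hn k hk => ?_⟩
    have hsmall : ∀ n ≥ N, C * (energy D ℓ (u n) - i) ≤ η / 4 := by
      intro n hn
      have h1 : energy D ℓ (u n) - i ≤ 1 / ((n : ℝ) + 1) := by linarith [hu n]
      have h2 : (N : ℝ) ≤ n := by exact_mod_cast hn
      refine (mul_le_mul_of_nonneg_left h1 hC0).trans ?_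
      rw [mul_one_div, div_le_iff₀ (by positivity)]
      rw [div_lt_iff₀ hη] at hN
      nlinarith
    have h1 := hC i hle (u n) (u k)
    have h2 : η / (4 * (B + 1)) * (‖D (u n)‖ ^ p + ‖D (u k)‖ ^ p) < η / 2 := by
      have h3 : ‖D (u n)‖ ^ p + ‖D (u k)‖ ^ p < 2 * (B + 1) := by linarith [huB n, huB k]
      calc _ < η / (4 * (B + 1)) * (2 * (B + 1)) := mul_lt_mul_of_pos_left h3 (by positivity)
        _ = η / 2 := by field_simp; norm_num
    have h4 : ‖D (u n - u k)‖ ^ p < η := by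
      rw [mul_add] at h1
      linarith [hsmall n hn, hsmall k hk]
    have h5 := (Real.rpow_lt_rpow_iff (norm_nonneg _) (by positivity) hp0).mp h4
    rw [dist_eq_norm]
    exact lt_of_mul_lt_mul_left ((hD _).trans_lt h5) hc.le
  obtain ⟨f, hf⟩ := cauchySeq_tendsto_of_complete hcauchy
  refine ⟨f, fun g => le_trans ?_ (hle g)⟩
  have hcont : Continuous (energy D ℓ) :=
    ((D.continuous.norm.rpow_const fun _ => Or.inr hp0.le).div_const _).sub ℓ.continuous
  have hlim : Tendsto (fun n : ℕ => i + 1 / ((n : ℝ) + 1)) atTop (𝓝 (i + 0)) :=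
    tendsto_const_nhds.add tendsto_one_div_add_atTop_nhds_zero_nat
  rw [add_zero] at hlim
  exact le_of_tendsto_of_tendsto' ((hcont.tendsto f).comp hf) hlim fun n => (hu n).le

theorem existsUnique_isWeakSolution [CompleteSpace F] (hp : 1 < p) {c : ℝ} (hc : 0 < c)
    (hD : ∀ f, c * ‖f‖ ≤ ‖D f‖) : ∃! f, IsWeakSolution D ℓ f := by
  obtain ⟨f, hf⟩ := exists_forall_energy_le (ℓ := ℓ) hp hc hD
  have hD0 : ∀ f, D f = 0 → f = 0 := by
    intro f h
    have h1 := hD f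
    rw [h, norm_zero] at h1
    exact norm_le_zero_iff.mp (nonpos_of_mul_nonpos_right h1 hc)
  exact ⟨f, isWeakSolution_of_energy_le hp hf,
    fun g hg => (eq_of_energy_le hp hD0 hf (hg.energy_le hp f)).symm⟩

theorem IsWeakSolution.map_eq (hp : 1 < p) {f : F} (hf : IsWeakSolution D ℓ f) :
    ℓ f = 1 / 2 * ‖D f‖ ^ p := by
  rw [← hf f, integral_signedPow_mul_self hp]

/-- The equation tested with `g`, then Hölder; `‖D f‖` is eliminated through `ℓ f = 1/2 ‖D f‖^p`. -/
theorem IsWeakSolution.map_rpow_le (hp : 1 < p) {f : F} (hf : IsWeakSolution D ℓ f) {g : F}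
    (hg : 0 ≤ ℓ g) : (ℓ g) ^ p ≤ (ℓ f) ^ (p - 1) * (1 / 2 * ‖D g‖ ^ p) := by
  have hp0 : 0 < p := by linarith
  have h1 : ℓ g ≤ 1 / 2 * (‖D f‖ ^ (p - 1) * ‖D g‖) := by
    rw [← hf g]
    exact mul_le_mul_of_nonneg_left (integral_signedPow_mul_le hp _ _) (by norm_num)
  refine (Real.rpow_le_rpow hg h1 hp0.le).trans (le_of_eq ?_)
  rw [hf.map_eq hp, Real.mul_rpow (by norm_num) (by positivity),
    Real.mul_rpow (by positivity) (norm_nonneg _), Real.mul_rpow (by norm_num) (by positivity),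
    ← Real.rpow_mul (norm_nonneg _), ← Real.rpow_mul (norm_nonneg _), mul_comm (p - 1) p]
  have e : (1 / 2 : ℝ) ^ p = (1 / 2) ^ (p - 1) * (1 / 2) := by
    rw [← Real.rpow_add_one (by norm_num), sub_add_cancel]
  rw [e]
  ring

end Variational

/-! ### The random walk and its gradient operator -/

section Walk

variable {X : Type*} [MeasurableSpace X] {m : Kernel X X} {ν : Measure X} {Ω : Set X} {p : ℝ}

theorem subset_mClosure (m : Kernel X X) (Ω : Set X) : Ω ⊆ mClosure m Ω := subset_union_left

theorem measurableSet_mClosure (m : Kernel X X) (hΩ : MeasurableSet Ω) :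
    MeasurableSet (mClosure m Ω) := by
  have h : MeasurableSet {x | 0 < m x Ω} := measurableSet_lt measurable_const (m.measurable_coe hΩ)
  exact hΩ.union (hΩ.compl.inter h)

/-- Reversibility is equality on rectangles, a generating π-system. The strips `spanningSets ν n ×ˢ
univ` exhaust the product and have finite mass because `m` is Markov. -/
theorem measurePreserving_swap_compProd [IsMarkovKernel m] [SigmaFinite ν]
    (hrev : m.IsReversible ν) : MeasurePreserving Prod.swap (ν ⊗ₘ m) (ν ⊗ₘ m) := by
  refine ⟨measurable_swap, Eq.symm ?_⟩
  refine Measure.ext_of_generateFrom_of_iUnion _ (fun n => spanningSets ν n ×ˢ univ)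
    generateFrom_prod.symm isPiSystem_prod ?_ ?_ ?_ ?_
  · rw [← iUnion_prod_const, iUnion_spanningSets, univ_prod_univ]
  · exact fun n => ⟨_, measurableSet_spanningSets ν n, _, MeasurableSet.univ, rfl⟩
  · intro n
    rw [Measure.compProd_apply_prod (measurableSet_spanningSets ν n) .univ]
    simpa using (measure_spanningSets_lt_top ν n).ne
  · rintro _ ⟨s, hs, t, ht, rfl⟩
    rw [Measure.map_apply measurable_swap (hs.prod ht), preimage_swap_prod,
      Measure.compProd_apply_prod hs ht, Measure.compProd_apply_prod ht hs]
    exact hrev hs ht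

theorem measurePreserving_fst_compProd (m : Kernel X X) [IsMarkovKernel m] (ν : Measure X)
    [SigmaFinite ν] : MeasurePreserving Prod.fst (ν ⊗ₘ m) ν :=
  ⟨measurable_fst, Measure.fst_compProd ν m⟩

theorem measurePreserving_snd_compProd [IsMarkovKernel m] [SigmaFinite ν]
    (hrev : m.IsReversible ν) : MeasurePreserving Prod.snd (ν ⊗ₘ m) ν :=
  (measurePreserving_fst_compProd m ν).comp (measurePreserving_swap_compProd hrev)

/-- By reversibility the mass of `Ω × Ω_mᶜ` is the integral of `m x Ω` over `Ω_mᶜ`, where `m x Ω =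
0` by definition of the boundary. The second half follows by symmetry. -/
theorem ae_compProd_mem_mClosure [IsMarkovKernel m] [SigmaFinite ν]
    (hrev : m.IsReversible ν) (hΩ : MeasurableSet Ω) :
    ∀ᵐ z ∂(ν ⊗ₘ m), (z.1 ∈ Ω → z.2 ∈ mClosure m Ω) ∧ (z.2 ∈ Ω → z.1 ∈ mClosure m Ω) := by
  have hm := measurableSet_mClosure m hΩ
  have h : ∀ᵐ z ∂(ν ⊗ₘ m), z.1 ∈ Ω → z.2 ∈ mClosure m Ω := by
    have h0 : (ν ⊗ₘ m) (Ω ×ˢ (mClosure m Ω)ᶜ) = 0 := by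
      rw [Measure.compProd_apply_prod hΩ hm.compl, hrev hΩ hm.compl,
        setLIntegral_congr_fun hm.compl (g := fun _ => 0), lintegral_zero]
      intro x hx
      by_contra h
      exact hx (or_iff_not_imp_left.mpr fun hxΩ => ⟨hxΩ, pos_iff_ne_zero.mpr h⟩)
    filter_upwards [compl_mem_ae_iff.mpr h0] with z hz h1
    by_contra h2
    exact hz ⟨h1, h2⟩
  filter_upwards [h, (measurePreserving_swap_compProd hrev).quasiMeasurePreserving.ae h]
    with z h1 h2 using ⟨h1, h2⟩

theorem nonlocalGrad_congr [IsMarkovKernel m] [SigmaFinite ν] (hrev : m.IsReversible ν)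
    {u v : X → ℝ} (h : u =ᵐ[ν] v) : nonlocalGrad u =ᵐ[ν ⊗ₘ m] nonlocalGrad v := by
  filter_upwards [(measurePreserving_fst_compProd m ν).quasiMeasurePreserving.ae h,
    (measurePreserving_snd_compProd hrev).quasiMeasurePreserving.ae h] with z h1 h2
  simp only [nonlocalGrad, h1, h2]

theorem memLp_nonlocalGrad [IsMarkovKernel m] [SigmaFinite ν] (hrev : m.IsReversible ν)
    {u : X → ℝ} (hu : MemLp u (ENNReal.ofReal p) ν) :
    MemLp (nonlocalGrad u) (ENNReal.ofReal p) (ν ⊗ₘ m) :=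
  (hu.comp_measurePreserving (measurePreserving_snd_compProd hrev)).sub
    (hu.comp_measurePreserving (measurePreserving_fst_compProd m ν))

theorem memLp_indicator (hΩ : MeasurableSet Ω) (f : LpZero m ν Ω p) :
    MemLp (Ω.indicator f.1) (ENNReal.ofReal p) ν :=
  (memLp_indicator_iff_restrict hΩ).mpr
    ((Lp.memLp f.1).mono_measure (Measure.restrict_mono (subset_mClosure m Ω) le_rfl))

theorem ae_eq_indicator (hΩ : MeasurableSet Ω) (f : LpZero m ν Ω p) :
    f.1 =ᵐ[ν.restrict (mClosure m Ω)] Ω.indicator f.1 := by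
  filter_upwards [f.2, ae_restrict_mem (measurableSet_mClosure m hΩ)] with x h1 h2
  by_cases hx : x ∈ Ω
  · simp [hx]
  · simp [hx, h1 (h2.resolve_left hx)]

theorem indicator_ae_congr (hΩ : MeasurableSet Ω) {u v : X → ℝ}
    (h : u =ᵐ[ν.restrict (mClosure m Ω)] v) : Ω.indicator u =ᵐ[ν] Ω.indicator v := by
  have h2 : ∀ᵐ x ∂ν.restrict Ω, u x = v x :=
    ae_mono (Measure.restrict_mono (subset_mClosure m Ω) le_rfl) h
  rw [ae_restrict_iff' hΩ] at h2
  filter_upwards [h2] with x hx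
  by_cases hxΩ : x ∈ Ω
  · simp [hxΩ, hx hxΩ]
  · simp [hxΩ]

theorem exists_LpZero_ae_eq (hΩ : MeasurableSet Ω) {u : X → ℝ}
    (hu : MemLp u (ENNReal.ofReal p) (ν.restrict (mClosure m Ω))) (h0 : ∀ x ∉ Ω, u x = 0) :
    ∃ h : LpZero m ν Ω p, h.1 =ᵐ[ν.restrict (mClosure m Ω)] u ∧ Ω.indicator h.1 =ᵐ[ν] u := by
  have hc := hu.coeFn_toLp
  refine ⟨⟨hu.toLp, ?_⟩, hc, ?_⟩
  · filter_upwards [hc] with x hx hxb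
    rw [hx, h0 x hxb.1]
  · have h := indicator_ae_congr hΩ hc
    rwa [indicator_eq_self.mpr fun x hx => by_contra fun hxΩ => hx (h0 x hxΩ)] at h

/-- The subspace is the kernel of the continuous restriction to the boundary; this supplies the
completeness needed for existence. -/
theorem isClosed_LpZero [Fact (1 ≤ ENNReal.ofReal p)] (hΩ : MeasurableSet Ω) :
    IsClosed (LpZero m ν Ω p : Set (Lp ℝ (ENNReal.ofReal p) (ν.restrict (mClosure m Ω)))) := by
  have hb : MeasurableSet (mBoundary m Ω) :=
    hΩ.compl.inter (measurableSet_lt measurable_const (m.measurable_coe hΩ))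
  set L := LpToLpRestrictCLM X ℝ ℝ (ν.restrict (mClosure m Ω)) (ENNReal.ofReal p) (mBoundary m Ω)
  have h : (LpZero m ν Ω p : Set (Lp ℝ (ENNReal.ofReal p) (ν.restrict (mClosure m Ω)))) =
      L ⁻¹' {0} := by
    ext f
    rw [mem_preimage, mem_singleton_iff, Lp.eq_zero_iff_ae_eq_zero]
    have hL := LpToLpRestrictCLM_coeFn ℝ (mBoundary m Ω) f
    change (∀ᵐ x ∂ν.restrict (mClosure m Ω), x ∈ mBoundary m Ω → f x = 0) ↔ _
    rw [← ae_restrict_iff' hb]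
    exact ⟨fun h => hL.trans h, fun h => hL.symm.trans h⟩
  rw [h]
  exact isClosed_singleton.preimage L.continuous

/-- The nonlocal gradient as a bounded operator on `L^p_0(Ω_m, ν)`; elements of the latter are
extended by zero. -/
def gradCLM (p : ℝ) [Fact (1 ≤ ENNReal.ofReal p)] [IsMarkovKernel m] [SigmaFinite ν]
    (hrev : m.IsReversible ν) (hΩ : MeasurableSet Ω) :
    LpZero m ν Ω p →L[ℝ] Lp ℝ (ENNReal.ofReal p) (ν ⊗ₘ m) :=
  LinearMap.mkContinuous
    { toFun := fun f => (memLp_nonlocalGrad hrev (memLp_indicator hΩ f)).toLp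
      map_add' := by
        intro f g
        rw [← MemLp.toLp_add]
        refine MemLp.toLp_congr _ _ ((nonlocalGrad_congr hrev
          (indicator_ae_congr hΩ (Lp.coeFn_add f.1 g.1))).trans ?_)
        refine Filter.Eventually.of_forall fun z => ?_
        simp only [nonlocalGrad, indicator_add', Pi.add_apply]
        ring
      map_smul' := by
        intro c f
        rw [RingHom.id_apply, ← MemLp.toLp_const_smul]
        refine MemLp.toLp_congr _ _ ((nonlocalGrad_congr hrev
          (indicator_ae_congr hΩ (Lp.coeFn_smul c f.1))).trans ?_)
        refine Filter.Eventually.of_forall fun z => ?_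
        have e : ∀ w, Ω.indicator (c • (f.1 : X → ℝ)) w = c * Ω.indicator f.1 w := by
          intro w
          by_cases hw : w ∈ Ω <;> simp [hw]
        simp only [nonlocalGrad, e, Pi.smul_apply, smul_eq_mul]
        ring }
    -- Both marginals of `ν ⊗ₘ m` are `ν`, so each of the two terms of the gradient contributes at
    -- most `‖f‖`.
    2 (by
      intro f
      have hu := memLp_indicator hΩ f
      have hfst := measurePreserving_fst_compProd m ν
      have hsnd := measurePreserving_snd_compProd hrev
      have hle : eLpNorm (Ω.indicator f.1) (ENNReal.ofReal p) ν ≤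
          eLpNorm f.1 (ENNReal.ofReal p) (ν.restrict (mClosure m Ω)) := by
        rw [eLpNorm_indicator_eq_eLpNorm_restrict hΩ]
        exact eLpNorm_mono_measure _ (Measure.restrict_mono (subset_mClosure m Ω) le_rfl)
      have h := eLpNorm_sub_le (hu.1.comp_measurePreserving hsnd)
        (hu.1.comp_measurePreserving hfst) (Fact.out : 1 ≤ ENNReal.ofReal p)
      rw [eLpNorm_comp_measurePreserving hu.1 hsnd, eLpNorm_comp_measurePreserving hu.1 hfst] at h
      have h2 := ENNReal.toReal_mono (ENNReal.add_ne_top.mpr ⟨Lp.eLpNorm_ne_top f.1,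
        Lp.eLpNorm_ne_top f.1⟩) (h.trans (add_le_add hle hle))
      rw [ENNReal.toReal_add (Lp.eLpNorm_ne_top f.1) (Lp.eLpNorm_ne_top f.1), ← two_mul] at h2
      change ‖(memLp_nonlocalGrad hrev hu).toLp‖ ≤ _
      rw [Lp.norm_toLp]
      exact h2)

theorem gradCLM_ae_eq [Fact (1 ≤ ENNReal.ofReal p)] [IsMarkovKernel m] [SigmaFinite ν]
    (hrev : m.IsReversible ν) (hΩ : MeasurableSet Ω) (f : LpZero m ν Ω p) :
    gradCLM p hrev hΩ f =ᵐ[ν ⊗ₘ m] nonlocalGrad (Ω.indicator f.1) :=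
  MemLp.coeFn_toLp (memLp_nonlocalGrad hrev (memLp_indicator hΩ f))

theorem memLp_restrict (f : LpZero m ν Ω p) : MemLp f.1 (ENNReal.ofReal p) (ν.restrict Ω) :=
  (Lp.memLp f.1).mono_measure (Measure.restrict_mono (subset_mClosure m Ω) le_rfl)

theorem integrableOn_LpZero (hp : 1 < p) (hfin : ν Ω < ⊤) (f : LpZero m ν Ω p) :
    IntegrableOn f.1 Ω ν := by
  have : IsFiniteMeasure (ν.restrict Ω) := ⟨by simpa using hfin⟩
  exact (memLp_restrict f).integrable (by simpa using hp.le)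

/-- Integration over `Ω` as a bounded functional on `L^p_0(Ω_m, ν)`. -/
def integralCLM [Fact (1 ≤ ENNReal.ofReal p)] (m : Kernel X X) (hp : 1 < p) (hfin : ν Ω < ⊤) :
    LpZero m ν Ω p →L[ℝ] ℝ :=
  LinearMap.mkContinuous
    { toFun := fun f => ∫ x in Ω, f.1 x ∂ν
      map_add' := by
        intro f g
        rw [← integral_add (integrableOn_LpZero hp hfin f) (integrableOn_LpZero hp hfin g)]
        exact integral_congr_ae (ae_mono (Measure.restrict_mono (subset_mClosure m Ω) le_rfl)
          (Lp.coeFn_add f.1 g.1))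
      map_smul' := by
        intro c f
        rw [RingHom.id_apply, smul_eq_mul, ← integral_const_mul]
        exact integral_congr_ae (ae_mono (Measure.restrict_mono (subset_mClosure m Ω) le_rfl)
          (Lp.coeFn_smul c f.1)) }
    -- Hölder's constant `ν(Ω)^(1 - 1/p)`.
    ((ν Ω) ^ (1 / (1 : ENNReal).toReal - 1 / (ENNReal.ofReal p).toReal)).toReal (by
      intro f
      have hexp : 0 ≤ 1 / (1 : ENNReal).toReal - 1 / (ENNReal.ofReal p).toReal := by
        rw [ENNReal.toReal_one, ENNReal.toReal_ofReal (by linarith), sub_nonneg]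
        exact one_div_le_one_div_of_le one_pos hp.le
      have hf := memLp_restrict f
      have h1 := eLpNorm_le_eLpNorm_mul_rpow_measure_univ (p := 1) (q := ENNReal.ofReal p)
        Fact.out hf.1
      rw [Measure.restrict_apply_univ] at h1
      have h2 : eLpNorm f.1 (ENNReal.ofReal p) (ν.restrict Ω) ≤
          eLpNorm f.1 (ENNReal.ofReal p) (ν.restrict (mClosure m Ω)) :=
        eLpNorm_mono_measure _ (Measure.restrict_mono (subset_mClosure m Ω) le_rfl)
      have h3 := ENNReal.toReal_mono (ENNReal.mul_ne_top (Lp.eLpNorm_ne_top f.1)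
        (ENNReal.rpow_ne_top_of_nonneg hexp hfin.ne)) (h1.trans (mul_le_mul_left h2 _))
      rw [ENNReal.toReal_mul, mul_comm] at h3
      refine (norm_integral_le_integral_norm _).trans (le_trans (le_of_eq ?_) h3)
      rw [integral_norm_eq_lintegral_enorm hf.1, eLpNorm_one_eq_lintegral_enorm])

theorem integralCLM_apply [Fact (1 ≤ ENNReal.ofReal p)] (hp : 1 < p) (hfin : ν Ω < ⊤)
    (f : LpZero m ν Ω p) : integralCLM m hp hfin f = ∫ x in Ω, f.1 x ∂ν := rfl

/-- Almost every pair outside `Ω_m × Ω_m` has both coordinates outside `Ω`, where the zero extension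
has no gradient. -/
theorem gradIntegral_eq_norm_rpow [Fact (1 ≤ ENNReal.ofReal p)] [IsMarkovKernel m] [SigmaFinite ν]
    (hrev : m.IsReversible ν) (hΩ : MeasurableSet Ω) (hp : 1 < p) (f : LpZero m ν Ω p) :
    gradIntegral m ν Ω p f.1 = ‖gradCLM p hrev hΩ f‖ ^ p := by
  have hm := measurableSet_mClosure m hΩ
  rw [Lp_norm_rpow_eq hp, gradIntegral, ← integral_indicator (hm.prod hm)]
  have h0 := ae_eq_indicator hΩ f
  rw [Filter.EventuallyEq, ae_restrict_iff' hm] at h0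
  refine integral_congr_ae ?_
  filter_upwards [gradCLM_ae_eq hrev hΩ f, ae_compProd_mem_mClosure hrev hΩ,
    (measurePreserving_fst_compProd m ν).quasiMeasurePreserving.ae h0,
    (measurePreserving_snd_compProd hrev).quasiMeasurePreserving.ae h0] with z h1 h2 h3 h4
  rw [h1]
  by_cases hz : z ∈ mClosure m Ω ×ˢ mClosure m Ω
  · rw [indicator_of_mem hz]
    simp only [nonlocalGrad]
    rw [h3 hz.1, h4 hz.2]
  · rw [indicator_of_notMem hz]
    have hz1 : z.1 ∉ Ω := fun h => hz ⟨subset_mClosure m Ω h, h2.1 h⟩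
    have hz2 : z.2 ∉ Ω := fun h => hz ⟨h2.2 h, subset_mClosure m Ω h⟩
    simp [nonlocalGrad, hz1, hz2, Real.zero_rpow (by linarith : p ≠ 0)]

theorem norm_rpow_eq_setIntegral [Fact (1 ≤ ENNReal.ofReal p)] (hΩ : MeasurableSet Ω)
    (hp : 1 < p) (f : LpZero m ν Ω p) : ‖f‖ ^ p = ∫ x in Ω, |f.1 x| ^ p ∂ν := by
  have h : ‖f‖ ^ p = ∫ x in mClosure m Ω, |f.1 x| ^ p ∂ν := Lp_norm_rpow_eq hp f.1
  rw [h]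
  refine setIntegral_eq_of_subset_of_ae_sdiff_eq_zero (measurableSet_mClosure m hΩ).nullMeasurableSet
    (subset_mClosure m Ω) ?_
  have h0 := ae_eq_indicator hΩ f
  rw [Filter.EventuallyEq, ae_restrict_iff' (measurableSet_mClosure m hΩ)] at h0
  filter_upwards [h0] with x hx hxd
  rw [hx hxd.1, indicator_of_notMem hxd.2, abs_zero, Real.zero_rpow (by linarith)]

theorem SatisfiesPoincare.exists_norm_le [Fact (1 ≤ ENNReal.ofReal p)] [IsMarkovKernel m]
    [SigmaFinite ν] (hP : SatisfiesPoincare m ν Ω p) (hrev : m.IsReversible ν)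
    (hΩ : MeasurableSet Ω) (hp : 1 < p) :
    ∃ c : ℝ, 0 < c ∧ ∀ f : LpZero m ν Ω p, c * ‖f‖ ≤ ‖gradCLM p hrev hΩ f‖ := by
  have hp0 : 0 < p := by linarith
  obtain ⟨c, hc, h⟩ := hP
  refine ⟨c ^ (1 / p), by positivity, fun f => ?_⟩
  have h1 := h f
  rw [← norm_rpow_eq_setIntegral hΩ hp, gradIntegral_eq_norm_rpow hrev hΩ hp] at h1
  rw [← Real.rpow_le_rpow_iff (by positivity) (norm_nonneg _) hp0,
    Real.mul_rpow (by positivity) (norm_nonneg _), ← Real.rpow_mul hc.le,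
    one_div_mul_cancel hp0.ne', Real.rpow_one]
  exact h1

/-- The gradient shrinks pointwise because `||a| - |b|| ≤ |a - b|`. -/
theorem exists_abs_LpZero [Fact (1 ≤ ENNReal.ofReal p)] [IsMarkovKernel m]
    [SigmaFinite ν] (hrev : m.IsReversible ν) (hΩ : MeasurableSet Ω) (f : LpZero m ν Ω p) :
    ∃ h : LpZero m ν Ω p, (h.1 =ᵐ[ν.restrict (mClosure m Ω)] fun x => |f.1 x|) ∧
      ‖gradCLM p hrev hΩ h‖ ≤ ‖gradCLM p hrev hΩ f‖ := by
  obtain ⟨h, h1, h2⟩ := exists_LpZero_ae_eq (m := m) hΩ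
    (u := fun x => |Ω.indicator f.1 x|) ((memLp_indicator hΩ f).abs.restrict _) (by simp +contextual)
  refine ⟨h, ?_, ?_⟩
  · filter_upwards [h1, ae_eq_indicator hΩ f] with x h3 h4
    rw [h3, ← h4]
  · refine Lp.norm_le_norm_of_ae_le ?_
    filter_upwards [gradCLM_ae_eq hrev hΩ h, gradCLM_ae_eq hrev hΩ f, nonlocalGrad_congr hrev h2]
      with z h3 h4 h5
    rw [h3, h4, h5]
    exact abs_abs_sub_abs_le _ _

end Walk

/-! ### The Dirichlet problem and the variational formula -/

section Dirichlet

theorem memLp_indicator_one {X : Type*} [MeasurableSpace X] {ν : Measure X} {Ω : Set X}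
    (hΩ : MeasurableSet Ω) (hfin : ν Ω < ⊤) (p : ℝ) {A : Set X} (hA : MeasurableSet A) :
    MemLp ((A ∩ Ω).indicator fun _ => (1 : ℝ)) (ENNReal.ofReal p) ν :=
  memLp_indicator_const _ (hA.inter hΩ) 1
    (Or.inr ((measure_mono inter_subset_right).trans_lt hfin).ne)

variable {X : Type*} [MeasurableSpace X] {m : Kernel X X} {ν : Measure X} {Ω : Set X} {p : ℝ}
  [IsMarkovKernel m] [SigmaFinite ν]

theorem integrable_signedPow_nonlocalGrad_mul_fst (hrev : m.IsReversible ν) (hp : 1 < p)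
    {u v : X → ℝ} (hu : MemLp u (ENNReal.ofReal p) ν) (hv : MemLp v (ENNReal.ofReal p) ν) :
    Integrable (fun z : X × X => signedPow p (nonlocalGrad u z) * v z.1) (ν ⊗ₘ m) :=
  integrable_signedPow_mul hp (memLp_nonlocalGrad hrev hu)
    (hv.comp_measurePreserving (measurePreserving_fst_compProd m ν))

/-- Nonlocal integration by parts. -/
theorem integral_signedPow_nonlocalGrad_mul (hrev : m.IsReversible ν) (hp : 1 < p)
    {u v : X → ℝ} (hu : MemLp u (ENNReal.ofReal p) ν) (hv : MemLp v (ENNReal.ofReal p) ν) :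
    1 / 2 * ∫ z, signedPow p (nonlocalGrad u z) * nonlocalGrad v z ∂(ν ⊗ₘ m) =
      -∫ x, (∫ y, signedPow p (u y - u x) ∂(m x)) * v x ∂ν := by
  have hsw := measurePreserving_swap_compProd hrev
  have i1 := integrable_signedPow_nonlocalGrad_mul_fst hrev hp hu hv
  -- Swapping `x` and `y` preserves the measure and flips the sign of `signedPow`, so the `v y` and
  -- `v x` terms have opposite integrals; the resulting factor 2 cancels `1/2`.
  have e1 : ∀ z : X × X, signedPow p (nonlocalGrad u z) * v z.2 =
      -(signedPow p (nonlocalGrad u z.swap) * v z.swap.1) := by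
    intro z
    have : nonlocalGrad u z.swap = -nonlocalGrad u z := by simp [nonlocalGrad]
    rw [this, signedPow_neg, Prod.fst_swap]
    ring
  have i2 : Integrable (fun z : X × X => signedPow p (nonlocalGrad u z) * v z.2) (ν ⊗ₘ m) := by
    simp only [e1]
    exact (hsw.integrable_comp_of_integrable i1).neg
  have e2 : ∫ z, signedPow p (nonlocalGrad u z) * v z.2 ∂(ν ⊗ₘ m) =
      -∫ z, signedPow p (nonlocalGrad u z) * v z.1 ∂(ν ⊗ₘ m) := by
    simp only [e1]
    rw [integral_neg, hsw.integral_comp MeasurableEquiv.prodComm.measurableEmbedding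
      (fun z => signedPow p (nonlocalGrad u z) * v z.1)]
  have e3 : ∫ z, signedPow p (nonlocalGrad u z) * nonlocalGrad v z ∂(ν ⊗ₘ m) =
      -(2 * ∫ z, signedPow p (nonlocalGrad u z) * v z.1 ∂(ν ⊗ₘ m)) := by
    have e : ∀ z, signedPow p (nonlocalGrad u z) * nonlocalGrad v z =
        signedPow p (nonlocalGrad u z) * v z.2 - signedPow p (nonlocalGrad u z) * v z.1 :=
      fun z => mul_sub _ _ _
    simp only [e]
    rw [integral_sub i2 i1, e2]
    ring
  rw [e3, Measure.integral_compProd i1]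
  simp only [nonlocalGrad, integral_mul_const]
  ring

/-- Fubini with the test function `1_Ω`, which lies in `L^p` because `ν Ω < ⊤`. -/
theorem ae_integrable_signedPow (hrev : m.IsReversible ν) (hΩ : MeasurableSet Ω)
    (hfin : ν Ω < ⊤) (hp : 1 < p) {u : X → ℝ} (hu : MemLp u (ENNReal.ofReal p) ν) :
    (∀ᵐ x ∂ν.restrict Ω, Integrable (fun y => signedPow p (u y - u x)) (m x)) ∧
      IntegrableOn (fun x => ∫ y, signedPow p (u y - u x) ∂(m x)) Ω ν := by
  have h := integrable_signedPow_nonlocalGrad_mul_fst hrev hp hu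
    (memLp_indicator_one hΩ hfin p MeasurableSet.univ)
  simp only [univ_inter] at h
  constructor
  · rw [ae_restrict_iff' hΩ]
    have h1 := ((Measure.integrable_compProd_iff h.1).mp h).1
    filter_upwards [h1] with x hx hxΩ
    simpa [hxΩ, nonlocalGrad] using hx
  · rw [← integrable_indicator_iff hΩ]
    have h1 := h.integral_compProd
    refine h1.congr (Filter.Eventually.of_forall fun x => ?_)
    by_cases hx : x ∈ Ω <;> simp [hx, nonlocalGrad]

/-- For a.e. `x ∈ Ω` the measure `m x` is carried by `Ω_m`, where `f` agrees `m x`-a.e. with its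
zero extension. The integrability clause then holds automatically. -/
theorem isDirichletSolution_iff_ae (hrev : m.IsReversible ν) (hΩ : MeasurableSet Ω)
    (hfin : ν Ω < ⊤) (hp : 1 < p) (g : X → ℝ) (f : LpZero m ν Ω p) :
    IsDirichletSolution m ν Ω p g f ↔ ∀ᵐ x ∂ν.restrict Ω,
      -∫ y, signedPow p (Ω.indicator f.1 y - Ω.indicator f.1 x) ∂(m x) = g x := by
  have h0 := ae_eq_indicator hΩ f
  rw [Filter.EventuallyEq, ae_restrict_iff' (measurableSet_mClosure m hΩ)] at h0
  have h1 : ∀ᵐ x ∂ν, ∀ᵐ y ∂(m x), (x ∈ Ω → y ∈ mClosure m Ω) ∧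
      (y ∈ mClosure m Ω → f.1 y = Ω.indicator f.1 y) := by
    refine Measure.ae_ae_of_ae_compProd (p := fun z : X × X => (z.1 ∈ Ω → z.2 ∈ mClosure m Ω) ∧
      (z.2 ∈ mClosure m Ω → f.1 z.2 = Ω.indicator f.1 z.2)) ?_
    filter_upwards [ae_compProd_mem_mClosure hrev hΩ,
      (measurePreserving_snd_compProd hrev).quasiMeasurePreserving.ae h0] with z h2 h3
      using ⟨h2.1, h3⟩
  refine Filter.eventually_congr ?_
  filter_upwards [ae_restrict_mem hΩ, ae_restrict_of_ae h1,
    (ae_integrable_signedPow hrev hΩ hfin hp (memLp_indicator hΩ f)).1] with x hx h2 h3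
  have hr : (m x).restrict (mClosure m Ω) = m x :=
    Measure.restrict_eq_self_of_ae_mem (h2.mono fun y hy => hy.1 hx)
  have he : (fun y => |f.1 y - f.1 x| ^ (p - 2) * (f.1 y - f.1 x)) =ᵐ[m x]
      fun y => signedPow p (Ω.indicator f.1 y - Ω.indicator f.1 x) := by
    filter_upwards [h2] with y hy
    rw [← hy.2 (hy.1 hx), indicator_of_mem hx, signedPow]
  rw [IntegrableOn, hr, integral_congr_ae he]
  exact and_iff_right (h3.congr he.symm)

theorem integral_signedPow_gradCLM_mul [Fact (1 ≤ ENNReal.ofReal p)]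
    (hrev : m.IsReversible ν) (hΩ : MeasurableSet Ω) (hp : 1 < p) (f h : LpZero m ν Ω p) :
    1 / 2 * ∫ z, signedPow p (gradCLM p hrev hΩ f z) * gradCLM p hrev hΩ h z ∂(ν ⊗ₘ m) =
      -∫ x in Ω, (∫ y, signedPow p (Ω.indicator f.1 y - Ω.indicator f.1 x) ∂(m x)) * h.1 x ∂ν := by
  have e : ∫ z, signedPow p (gradCLM p hrev hΩ f z) * gradCLM p hrev hΩ h z ∂(ν ⊗ₘ m) =
      ∫ z, signedPow p (nonlocalGrad (Ω.indicator f.1) z) *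
        nonlocalGrad (Ω.indicator h.1) z ∂(ν ⊗ₘ m) := by
    refine integral_congr_ae ?_
    filter_upwards [gradCLM_ae_eq hrev hΩ f, gradCLM_ae_eq hrev hΩ h] with z h1 h2
    rw [h1, h2]
  rw [e, integral_signedPow_nonlocalGrad_mul hrev hp (memLp_indicator hΩ f) (memLp_indicator hΩ h),
    ← integral_indicator hΩ]
  simp only [indicator_mul_right]

theorem IsDirichletSolution.isWeakSolution [Fact (1 ≤ ENNReal.ofReal p)]
    (hrev : m.IsReversible ν) (hΩ : MeasurableSet Ω) (hfin : ν Ω < ⊤) (hp : 1 < p)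
    {f : LpZero m ν Ω p} (hf : IsDirichletSolution m ν Ω p (fun _ => 1) f) :
    IsWeakSolution (gradCLM p hrev hΩ) (integralCLM m hp hfin) f := by
  intro h
  rw [integral_signedPow_gradCLM_mul hrev hΩ hp, integralCLM_apply, ← integral_neg]
  refine integral_congr_ae ?_
  filter_upwards [(isDirichletSolution_iff_ae hrev hΩ hfin hp _ f).mp hf] with x hx
  rw [← neg_mul, hx, one_mul]

/-- Testing with `1_{A ∩ Ω}` for every measurable `A` determines the integrand a.e. on `Ω`. -/
theorem IsWeakSolution.isDirichletSolution [Fact (1 ≤ ENNReal.ofReal p)]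
    (hrev : m.IsReversible ν) (hΩ : MeasurableSet Ω) (hfin : ν Ω < ⊤) (hp : 1 < p)
    {f : LpZero m ν Ω p} (hf : IsWeakSolution (gradCLM p hrev hΩ) (integralCLM m hp hfin) f) :
    IsDirichletSolution m ν Ω p (fun _ => 1) f := by
  rw [isDirichletSolution_iff_ae hrev hΩ hfin hp]
  have hG := (ae_integrable_signedPow hrev hΩ hfin hp (memLp_indicator hΩ f)).2
  have : IsFiniteMeasure (ν.restrict Ω) := ⟨by simpa using hfin⟩
  refine Integrable.ae_eq_of_forall_setIntegral_eq _ (fun _ => (1 : ℝ)) hG.neg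
    (integrable_const 1) fun A hA _ => ?_
  obtain ⟨h, h1, -⟩ := exists_LpZero_ae_eq (m := m) hΩ
    ((memLp_indicator_one hΩ hfin p hA).restrict _) (by simp +contextual)
  have h2 := ae_mono (Measure.restrict_mono (subset_mClosure m Ω) le_rfl) h1
  have h3 := hf h
  rw [integral_signedPow_gradCLM_mul hrev hΩ hp, integralCLM_apply, ← integral_neg] at h3
  rw [← integral_indicator hA, ← integral_indicator hA]
  refine (integral_congr_ae ?_).trans (h3.trans (integral_congr_ae ?_))
  · filter_upwards [h2, ae_restrict_mem hΩ] with x hx hxΩ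
    rw [hx]
    by_cases hxA : x ∈ A <;> simp [hxA, hxΩ]
  · filter_upwards [h2, ae_restrict_mem hΩ] with x hx hxΩ
    rw [hx]
    by_cases hxA : x ∈ A <;> simp [hxA, hxΩ]

theorem isDirichletSolution_iff_isWeakSolution [Fact (1 ≤ ENNReal.ofReal p)]
    (hrev : m.IsReversible ν) (hΩ : MeasurableSet Ω) (hfin : ν Ω < ⊤) (hp : 1 < p)
    (f : LpZero m ν Ω p) : IsDirichletSolution m ν Ω p (fun _ => 1) f ↔
      IsWeakSolution (gradCLM p hrev hΩ) (integralCLM m hp hfin) f :=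
  ⟨fun hf => hf.isWeakSolution hrev hΩ hfin hp, fun hf => hf.isDirichletSolution hrev hΩ hfin hp⟩

/-- Replacing `f` by `|f|` does not increase the gradient term and does not decrease `∫_Ω f`, so
`|f|` is also a minimiser; uniqueness gives `f = |f|`. -/
theorem IsDirichletSolution.nonneg [Fact (1 ≤ ENNReal.ofReal p)]
    (hP : SatisfiesPoincare m ν Ω p) (hrev : m.IsReversible ν) (hΩ : MeasurableSet Ω)
    (hfin : ν Ω < ⊤) (hp : 1 < p) {f : LpZero m ν Ω p}
    (hf : IsDirichletSolution m ν Ω p (fun _ => 1) f) :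
    ∀ᵐ x ∂ν.restrict (mClosure m Ω), 0 ≤ f.1 x := by
  rw [isDirichletSolution_iff_isWeakSolution hrev hΩ hfin hp] at hf
  obtain ⟨c, hc, hD⟩ := hP.exists_norm_le hrev hΩ hp
  obtain ⟨h, h1, h2⟩ := exists_abs_LpZero hrev hΩ f
  have hp0 : 0 < p := by linarith
  have hE : energy (gradCLM p hrev hΩ) (integralCLM m hp hfin) h ≤
      energy (gradCLM p hrev hΩ) (integralCLM m hp hfin) f := by
    refine sub_le_sub (div_le_div_of_nonneg_right
      (Real.rpow_le_rpow (norm_nonneg _) h2 hp0.le) (by positivity)) ?_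
    rw [integralCLM_apply, integralCLM_apply]
    refine integral_mono_ae (integrableOn_LpZero hp hfin f) (integrableOn_LpZero hp hfin h) ?_
    filter_upwards [ae_mono (Measure.restrict_mono (subset_mClosure m Ω) le_rfl) h1] with x hx
    rw [hx]
    exact le_abs_self _
  have hfh : f = h := by
    refine eq_of_energy_le hp (fun g hg => ?_) (hf.energy_le hp) hE
    have h3 := hD g
    rw [hg, norm_zero] at h3
    exact norm_le_zero_iff.mp (nonpos_of_mul_nonpos_right h3 hc)
  rw [← hfh] at h1
  filter_upwards [h1] with x hx
  rw [hx]
  exact abs_nonneg _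

theorem pTorsion_properties (hrev : m.IsReversible ν) (hΩ : MeasurableSet Ω)
    (hpos : 0 < ν Ω) (hfin : ν Ω < ⊤) (hp : 1 < p) (hP : SatisfiesPoincare m ν Ω p) :
    (∃! f : LpZero m ν Ω p, IsDirichletSolution m ν Ω p (fun _ => 1) f) ∧
      (∀ᵐ x ∂ν.restrict (mClosure m Ω), 0 ≤ (pTorsionFunction m ν Ω p).1 x) ∧
      (∀ g : LpZero m ν Ω p, g ≠ 0 → pTorsionQuotient m ν Ω p g ≤ pTorsionalRigidity m ν Ω p) ∧
      pTorsionFunction m ν Ω p ≠ 0 ∧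
      pTorsionQuotient m ν Ω p (pTorsionFunction m ν Ω p) = pTorsionalRigidity m ν Ω p := by
  have hfact : Fact (1 ≤ ENNReal.ofReal p) := ⟨by simpa using hp.le⟩
  have hp0 : 0 < p := by linarith
  obtain ⟨c, hc, hD⟩ := hP.exists_norm_le hrev hΩ hp
  have : CompleteSpace (LpZero m ν Ω p) := (isClosed_LpZero hΩ).completeSpace_coe
  have hex : ∃! f : LpZero m ν Ω p, IsDirichletSolution m ν Ω p (fun _ => 1) f := by
    simp only [isDirichletSolution_iff_isWeakSolution hrev hΩ hfin hp]
    exact existsUnique_isWeakSolution hp hc hD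
  have hsol : IsDirichletSolution m ν Ω p (fun _ => 1) (pTorsionFunction m ν Ω p) := by
    rw [pTorsionFunction, dif_pos hex.exists]
    exact hex.exists.choose_spec
  have hnn := hsol.nonneg hP hrev hΩ hfin hp
  have hw := (isDirichletSolution_iff_isWeakSolution hrev hΩ hfin hp _).mp hsol
  have hint : ∫ x in Ω, |(pTorsionFunction m ν Ω p).1 x| ∂ν =
      ∫ x in Ω, (pTorsionFunction m ν Ω p).1 x ∂ν := by
    refine integral_congr_ae ?_
    filter_upwards [ae_mono (Measure.restrict_mono (subset_mClosure m Ω) le_rfl) hnn] with x hx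
    exact abs_of_nonneg hx
  set f := pTorsionFunction m ν Ω p with hf
  have hDpos : ∀ g : LpZero m ν Ω p, g ≠ 0 → 0 < 1 / 2 * ‖gradCLM p hrev hΩ g‖ ^ p := by
    intro g hg
    have h1 : 0 < ‖gradCLM p hrev hΩ g‖ := (mul_pos hc (norm_pos_iff.mpr hg)).trans_le (hD g)
    positivity
  -- If `f = 0`, the bound tested with `1_Ω` would read `ν(Ω)^p ≤ 0`.
  have hf0 : f ≠ 0 := by
    intro h0
    obtain ⟨h, h3, -⟩ := exists_LpZero_ae_eq (m := m) hΩ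
      ((memLp_indicator_one hΩ hfin p MeasurableSet.univ).restrict _) (by simp +contextual)
    have h4 := hw.map_rpow_le hp (g := h)
    have h5 : integralCLM m hp hfin h = ν.real Ω := by
      rw [integralCLM_apply, integral_congr_ae
        (ae_mono (Measure.restrict_mono (subset_mClosure m Ω) le_rfl) h3)]
      simp [integral_indicator_const, hΩ]
    have h6 : 0 < ν.real Ω := ENNReal.toReal_pos hpos.ne' hfin.ne
    rw [h5] at h4
    have h7 := h4 h6.le
    rw [h0, map_zero, Real.zero_rpow (by linarith), zero_mul] at h7
    exact absurd h7 (not_le.mpr (Real.rpow_pos_of_pos h6 p))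
  refine ⟨hex, hnn, fun g hg => ?_, hf0, ?_⟩
  · rw [pTorsionQuotient, gradIntegral_eq_norm_rpow hrev hΩ hp, div_le_iff₀ (hDpos g hg)]
    -- Taking `|g|` as test function turns `ℓ` into `∫_Ω |g|` without enlarging the denominator.
    obtain ⟨h, h1, h2⟩ := exists_abs_LpZero hrev hΩ g
    have h3 : integralCLM m hp hfin h = ∫ x in Ω, |g.1 x| ∂ν := by
      rw [integralCLM_apply]
      exact integral_congr_ae (ae_mono (Measure.restrict_mono (subset_mClosure m Ω) le_rfl) h1)
    have h4 : 0 ≤ ∫ x in Ω, |g.1 x| ∂ν := integral_nonneg fun _ => abs_nonneg _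
    have h5 := hw.map_rpow_le hp (h3 ▸ h4)
    rw [h3] at h5
    refine h5.trans (mul_le_mul_of_nonneg_left (mul_le_mul_of_nonneg_left
      (Real.rpow_le_rpow (norm_nonneg _) h2 hp0.le) (by norm_num)) ?_)
    rw [hw.map_eq hp]
    positivity
  · have h1 := hw.map_eq hp
    have h2 := hDpos f hf0
    rw [pTorsionQuotient, pTorsionalRigidity, hint, gradIntegral_eq_norm_rpow hrev hΩ hp, ← hf]
    -- The denominator at `f` equals `ℓ f`, so the quotient is `(ℓ f)^p / ℓ f`.
    rw [← h1, integralCLM_apply] at h2 ⊢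
    rw [Real.rpow_sub_one h2.ne']

end Dirichlet

/-! ### The linear case `p = 2` -/

theorem isStressFunction_iff {X : Type*} [MeasurableSpace X] {m : Kernel X X} {ν : Measure X}
    {Ω : Set X} (f : LpZero m ν Ω 2) :
    IsStressFunction m ν Ω f ↔ IsDirichletSolution m ν Ω 2 (fun _ => 1) f := by
  -- The weight is `|a| ^ 0 = 1`, also at `a = 0` by the convention `0 ^ 0 = 1`.
  simp [IsStressFunction, IsDirichletSolution]

theorem stressFunction_eq_pTorsionFunction {X : Type*} [MeasurableSpace X] (m : Kernel X X)
    (ν : Measure X) (Ω : Set X) : stressFunction m ν Ω = pTorsionFunction m ν Ω 2 := by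
  have h : IsStressFunction m ν Ω = IsDirichletSolution m ν Ω 2 fun _ => 1 :=
    funext fun f => propext (isStressFunction_iff f)
  rw [stressFunction, pTorsionFunction, h]

theorem torsionalRigidity_eq_pTorsionalRigidity {X : Type*} [MeasurableSpace X] (m : Kernel X X)
    (ν : Measure X) (Ω : Set X) : torsionalRigidity m ν Ω = pTorsionalRigidity m ν Ω 2 := by
  rw [torsionalRigidity, pTorsionalRigidity, stressFunction_eq_pTorsionFunction,
    show (2 : ℝ) - 1 = 1 by norm_num, Real.rpow_one]

theorem torsionQuotient_le_pTorsionQuotient {X : Type*} [MeasurableSpace X] {m : Kernel X X}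
    {ν : Measure X} {Ω : Set X} (g : LpZero m ν Ω 2) :
    torsionQuotient m ν Ω g ≤ pTorsionQuotient m ν Ω 2 g := by
  rw [torsionQuotient, pTorsionQuotient, Real.rpow_two]
  refine div_le_div_of_nonneg_right (sq_le_sq' ?_ ?_) ?_
  · exact neg_le_of_abs_le (abs_integral_le_integral_abs)
  · exact (le_abs_self _).trans (abs_integral_le_integral_abs)
  · exact mul_nonneg (by norm_num) (integral_nonneg fun _ => Real.rpow_nonneg (abs_nonneg _) _)

theorem torsionQuotient_eq_pTorsionQuotient {X : Type*} [MeasurableSpace X] {m : Kernel X X}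
    {ν : Measure X} {Ω : Set X} {g : LpZero m ν Ω 2}
    (hg : ∀ᵐ x ∂ν.restrict (mClosure m Ω), 0 ≤ g.1 x) :
    torsionQuotient m ν Ω g = pTorsionQuotient m ν Ω 2 g := by
  have h : ∫ x in Ω, |g.1 x| ∂ν = ∫ x in Ω, g.1 x ∂ν := by
    refine integral_congr_ae ?_
    filter_upwards [ae_mono (Measure.restrict_mono (subset_mClosure m Ω) le_rfl) hg] with x hx
    exact abs_of_nonneg hx
  rw [torsionQuotient, pTorsionQuotient, Real.rpow_two, h]

end RandomWalk

end

theorem mainTheorem6 {X : Type*} [MeasurableSpace X] [MeasurableSpace.CountablyGenerated X]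
    (m : Kernel X X) [IsMarkovKernel m] (ν : Measure X) [SigmaFinite ν]
    (hrev : m.IsReversible ν) (Ω : Set X) (hΩ : MeasurableSet Ω)
    (hpos : 0 < ν Ω) (hfin : ν Ω < ⊤) :
    (∀ p : ℝ, 1 < p → RandomWalk.SatisfiesPoincare m ν Ω p →
      (∃! f : RandomWalk.LpZero m ν Ω p,
        RandomWalk.IsDirichletSolution m ν Ω p (fun _ => 1) f) ∧
      (∀ᵐ x ∂ν.restrict (RandomWalk.mClosure m Ω),
        0 ≤ (RandomWalk.pTorsionFunction m ν Ω p).1 x) ∧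
      IsGreatest (RandomWalk.pTorsionQuotient m ν Ω p '' {g | g ≠ 0})
        (RandomWalk.pTorsionalRigidity m ν Ω p) ∧
      RandomWalk.pTorsionFunction m ν Ω p ≠ 0 ∧
      RandomWalk.pTorsionQuotient m ν Ω p (RandomWalk.pTorsionFunction m ν Ω p) =
        RandomWalk.pTorsionalRigidity m ν Ω p) ∧
    (RandomWalk.SatisfiesPoincare m ν Ω 2 →
      (∃! f : RandomWalk.LpZero m ν Ω 2, RandomWalk.IsStressFunction m ν Ω f) ∧
      RandomWalk.torsionalRigidity m ν Ω = RandomWalk.pTorsionalRigidity m ν Ω 2 ∧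
      IsGreatest (RandomWalk.torsionQuotient m ν Ω '' {g | g ≠ 0})
        (RandomWalk.torsionalRigidity m ν Ω) ∧
      RandomWalk.stressFunction m ν Ω ≠ 0 ∧
      RandomWalk.torsionQuotient m ν Ω (RandomWalk.stressFunction m ν Ω) =
        RandomWalk.torsionalRigidity m ν Ω) := by
  refine ⟨fun p hp hP => ?_, fun hP => ?_⟩
  · obtain ⟨h1, h2, h3, h4, h5⟩ := RandomWalk.pTorsion_properties hrev hΩ hpos hfin hp hP
    refine ⟨h1, h2, ⟨⟨_, h4, h5⟩, ?_⟩, h4, h5⟩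
    rintro _ ⟨g, hg, rfl⟩
    exact h3 g hg
  · obtain ⟨h1, h2, h3, h4, h5⟩ :=
      RandomWalk.pTorsion_properties hrev hΩ hpos hfin one_lt_two hP
    rw [RandomWalk.torsionalRigidity_eq_pTorsionalRigidity,
      RandomWalk.stressFunction_eq_pTorsionFunction]
    have h6 := (RandomWalk.torsionQuotient_eq_pTorsionQuotient h2).trans h5
    refine ⟨by simpa only [RandomWalk.isStressFunction_iff] using h1, rfl, ⟨⟨_, h4, h6⟩, ?_⟩,
      h4, h6⟩
    rintro _ ⟨g, hg, rfl⟩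
    exact (RandomWalk.torsionQuotient_le_pTorsionQuotient g).trans (h3 g hg)
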